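/- Let $M$ be a closed (compact, without boundary) smooth manifold of dimension $2n+1$, $n\ge 0$, with a co-oriented contact structure $\xi$, and let $\alpha$ be any contact form for it: a smooth $1$-form with $\alpha\wedge(d\alpha)^n$ nowhere vanishing, $\ker\alpha=\xi$, and $\alpha>0$ on the positive side of $\xi$. A contactomorphism is a diffeomorphism $\varphi$ of $M$ with $d\varphi(\xi)=\xi$. An isotopy is a family $(\varphi_t)_{t\in[0,1]}$ of contactomorphisms, smooth in $(t,x)$; it is generated by the time-dependent vector field $X_t$ defined by $X_t\circ\varphi_t=\frac{d}{dt}\varphi_t$. Let $\mathrm{Cont}_0(M)$ be the group of contactomorphisms that are isotopic to $\mathrm{id}_M$ through contactomorphisms. For $\varphi,\psi\in\mathrm{Cont}_0(M)$ put $$|\varphi|_\alpha=\inf\Big\{\int_0^1\max_M|\alpha(X_t)|\,dt \;:\; (\varphi_t)\text{ an isotopy with }\varphi_0=\mathrm{id}_M,\ \varphi_1=\varphi\Big\},\qquad d_\alpha(\varphi,\psi)=|\psi^{-1}\varphi|_\alpha ,$$ where $d_\alpha$ is the Shelukhin--Hofer metric. Its topology is the one in which a set $U$ is open iff for every $\varphi\in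 U$ there is $\varepsilon>0$ such that $d_\alpha(\varphi,\psi)<\varepsilon$ implies $\psi\in U$. Write $\varphi\ll\psi$ if there is a positive isotopy from $\varphi$ to $\psi$, that is, an isotopy with $\varphi_0=\varphi$, $\varphi_1=\psi$ and $\alpha(X_t)>0$ on all of $M$ for all $t\in[0,1]$ (this depends only on $\xi$ and its co-orientation), and let $$I^+(\varphi)=\{\psi\in\mathrm{Cont}_0(M):\varphi\ll\psi\},\qquad I^-(\varphi)=\{\psi\in\mathrm{Cont}_0(M):\psi\ll\varphi\}.$$ The interval topology on $\mathrm{Cont}_0(M)$ is the topology generated by the sets $I^+(\varphi)\cap I^-(\psi)$, $\varphi,\psi\in\mathrm{Cont}_0(M)$. Then the interval topology is coarser than (or equal to) the topology induced by $d_\alpha$: every set that is open in the interval topology is open with respect to $d_\alpha$. Moreover, for every $\varphi\in\mathrm{Cont}_0(M)$, the sets $I^+(\varphi)$ and $I^-(\varphi)$ are open with respect to $d_\alpha$. -/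

import Mathlib

open Set MeasureTheory
open scoped Manifold ContDiff Topology

noncomputable section

namespace ContactGeom

/-- The model space of a `(2n+1)`-dimensional manifold. -/
abbrev Model (n : ℕ) : Type := EuclideanSpace ℝ (Fin (2 * n + 1))

section Forms

variable {n : ℕ} {M : Type*} [TopologicalSpace M] [ChartedSpace (Model n) M]

/-- A `1`-form `α` near `p`, written in the preferred chart at `p`, as a `1`-form on `ℝ^(2n+1)`:
the pull-back of `α` under the inverse of the chart. -/
def formInChart (α : ∀ p : M, TangentSpace (𝓡 (2 * n + 1)) p →L[ℝ] ℝ) (p : M) :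
    Model n → Model n [⋀^Fin 1]→L[ℝ] ℝ :=
  fun x => ContinuousAlternatingMap.ofSubsingleton ℝ (Model n) ℝ (0 : Fin 1)
    ((α ((extChartAt (𝓡 (2 * n + 1)) p).symm x)).comp
      (mfderiv 𝓘(ℝ, Model n) (𝓡 (2 * n + 1)) (extChartAt (𝓡 (2 * n + 1)) p).symm x))

/-- The exterior derivative `(dα)_p (v, w)` of a `1`-form `α`, computed in the preferred chart
at `p`. -/
def extDerivForm (α : ∀ p : M, TangentSpace (𝓡 (2 * n + 1)) p →L[ℝ] ℝ) (p : M)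
    (v w : TangentSpace (𝓡 (2 * n + 1)) p) : ℝ :=
  extDeriv (formInChart α p) (extChartAt (𝓡 (2 * n + 1)) p p)
    ![mfderiv (𝓡 (2 * n + 1)) 𝓘(ℝ, Model n) (extChartAt (𝓡 (2 * n + 1)) p) p v,
      mfderiv (𝓡 (2 * n + 1)) 𝓘(ℝ, Model n) (extChartAt (𝓡 (2 * n + 1)) p) p w]

/-- The top-degree form `α ∧ (dα)^n`, evaluated at `p` on `2n+1` tangent vectors:
`(α ∧ (dα)^n)(v₀, …, v₂ₙ) = 2^(-n) ∑_σ sgn(σ) α(v_σ(0)) ∏_{i<n} dα(v_σ(2i+1), v_σ(2i+2))`. -/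
def contactVolume (α : ∀ p : M, TangentSpace (𝓡 (2 * n + 1)) p →L[ℝ] ℝ) (p : M)
    (v : Fin (2 * n + 1) → TangentSpace (𝓡 (2 * n + 1)) p) : ℝ :=
  (1 / 2 : ℝ) ^ n * ∑ σ : Equiv.Perm (Fin (2 * n + 1)),
    ((Equiv.Perm.sign σ : ℤ) : ℝ) * (α p (v (σ 0)) *
      ∏ i : Fin n, extDerivForm α p (v (σ ⟨2 * i.1 + 1, by omega⟩)) (v (σ ⟨2 * i.1 + 2, by omega⟩)))

variable (n M)

/-- A contact form on a `(2n+1)`-dimensional manifold: a smooth `1`-form `α` such that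
`α ∧ (dα)^n` vanishes nowhere. -/
structure ContactForm [IsManifold (𝓡 (2 * n + 1)) ∞ M] where
  /-- the underlying field of linear forms -/
  form : ∀ p : M, TangentSpace (𝓡 (2 * n + 1)) p →L[ℝ] ℝ
  smooth : ContMDiff (𝓡 (2 * n + 1)) ((𝓡 (2 * n + 1)).prod 𝓘(ℝ, Model n →L[ℝ] ℝ)) ∞
    (fun p => Bundle.TotalSpace.mk' (Model n →L[ℝ] ℝ)
      (E := fun p : M => TangentSpace (𝓡 (2 * n + 1)) p →L[ℝ] Bundle.Trivial M ℝ p) p (form p))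
  nondegenerate : ∀ p : M, ∃ v : Fin (2 * n + 1) → TangentSpace (𝓡 (2 * n + 1)) p,
    contactVolume form p v ≠ 0

/-- A co-oriented contact structure: a hyperplane field `ξ ⊂ TM` with a choice of the positive
side of each `ξ_p` in `T_p M`, for which there is a contact form `α` with `ξ = ker α` and positive
side `{α > 0}`. -/
structure CoorientedContactStructure [IsManifold (𝓡 (2 * n + 1)) ∞ M] where
  /-- the hyperplane field -/
  ξ : ∀ p : M, Submodule ℝ (TangentSpace (𝓡 (2 * n + 1)) p)
  /-- the positive side of the hyperplane field -/
  pos : ∀ p : M, Set (TangentSpace (𝓡 (2 * n + 1)) p)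
  exists_form : ∃ α : ContactForm n M, ∀ (p : M) (v : TangentSpace (𝓡 (2 * n + 1)) p),
    (v ∈ ξ p ↔ α.form p v = 0) ∧ (v ∈ pos p ↔ 0 < α.form p v)

variable {n M}

/-- `α` is a contact form for the co-oriented contact structure `C`: its kernel is `ξ` and it is
positive exactly on the positive side of `ξ`. -/
def ContactForm.Defines [IsManifold (𝓡 (2 * n + 1)) ∞ M] (α : ContactForm n M)
    (C : CoorientedContactStructure n M) : Prop :=
  ∀ (p : M) (v : TangentSpace (𝓡 (2 * n + 1)) p),
    (v ∈ C.ξ p ↔ α.form p v = 0) ∧ (v ∈ C.pos p ↔ 0 < α.form p v)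

end Forms

section Isotopies

variable {n : ℕ} {M : Type*} [TopologicalSpace M] [ChartedSpace (Model n) M]

variable (n M) in
/-- The diffeomorphisms of `M`. -/
abbrev Diff : Type _ := M ≃ₘ⟮𝓡 (2 * n + 1), 𝓡 (2 * n + 1)⟯ M

variable [IsManifold (𝓡 (2 * n + 1)) ∞ M] (C : CoorientedContactStructure n M)

/-- A diffeomorphism `φ` is a contactomorphism if `dφ(ξ_p) = ξ_φ(p)` for all `p`. -/
def IsContactomorphism (φ : Diff n M) : Prop :=
  ∀ p : M, (C.ξ p).map (mfderiv (𝓡 (2 * n + 1)) (𝓡 (2 * n + 1)) φ p).toLinearMap = C.ξ (φ p)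

/-- A smooth isotopy of contactomorphisms `(φ_t)`, `t ∈ [0,1]`. Values at times outside `[0,1]`
play no role. -/
structure ContactIsotopy where
  /-- the diffeomorphism at time `t` -/
  at' : ℝ → Diff n M
  contact : ∀ t ∈ Icc (0 : ℝ) 1, IsContactomorphism C (at' t)
  smooth : ContMDiffOn ((𝓘(ℝ, ℝ)).prod (𝓡 (2 * n + 1))) (𝓡 (2 * n + 1)) ∞
    (fun x : ℝ × M => at' x.1 x.2) (Icc (0 : ℝ) 1 ×ˢ (univ : Set M))

variable {C}

/-- The vector `X_t(φ_t(p)) = d/ds|_{s=t} φ_s(p)` (one-sided derivative at `t = 0, 1`), a tangent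
vector at `φ_t(p)`. -/
def ContactIsotopy.velocity (Φ : ContactIsotopy C) (t : ℝ) (p : M) :
    TangentSpace (𝓡 (2 * n + 1)) (Φ.at' t p) :=
  mfderivWithin 𝓘(ℝ, ℝ) (𝓡 (2 * n + 1)) (fun s : ℝ => Φ.at' s p) (Icc 0 1) t (1 : ℝ)

/-- The isotopy is positive: `α(X_t) > 0` on `M` for all `t ∈ [0,1]`. As `φ_t` is bijective, every
point of `M` is of the form `φ_t(p)`. -/
def ContactIsotopy.IsPositive (Φ : ContactIsotopy C) : Prop :=
  ∀ t ∈ Icc (0 : ℝ) 1, ∀ p : M, Φ.velocity t p ∈ C.pos (Φ.at' t p)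

/-- `∫₀¹ max_M |α(X_t)| dt`. As `φ_t` is bijective, the maximum over `M` is the supremum over `p`
of the values at the points `φ_t(p)`. -/
def ContactIsotopy.length (Φ : ContactIsotopy C) (α : ContactForm n M) : ℝ :=
  ∫ t in (0 : ℝ)..1, ⨆ p : M, |α.form (Φ.at' t p) (Φ.velocity t p)|

/-! Closure of contactomorphisms and isotopies under the group operations. -/

theorem IsContactomorphism.refl :
    IsContactomorphism C (Diffeomorph.refl (𝓡 (2 * n + 1)) M ∞) := by
  intro p
  have h : mfderiv (𝓡 (2 * n + 1)) (𝓡 (2 * n + 1))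
      (Diffeomorph.refl (𝓡 (2 * n + 1)) M ∞) p = ContinuousLinearMap.id ℝ _ := by
    rw [Diffeomorph.coe_refl]; exact mfderiv_id
  rw [h]
  exact Submodule.map_id _

theorem IsContactomorphism.trans {φ ψ : Diff n M} (hφ : IsContactomorphism C φ)
    (hψ : IsContactomorphism C ψ) : IsContactomorphism C (φ.trans ψ) := by
  intro p
  have h : mfderiv (𝓡 (2 * n + 1)) (𝓡 (2 * n + 1)) (φ.trans ψ) p =
      (mfderiv (𝓡 (2 * n + 1)) (𝓡 (2 * n + 1)) ψ (φ p)).comp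
        (mfderiv (𝓡 (2 * n + 1)) (𝓡 (2 * n + 1)) φ p) := by
    rw [Diffeomorph.coe_trans]
    exact mfderiv_comp p (ψ.mdifferentiable (by simp) _) (φ.mdifferentiable (by simp) _)
  rw [h]
  have h2 := hψ (φ p)
  rw [← hφ p, ← Submodule.map_comp] at h2
  exact h2

theorem IsContactomorphism.symm {φ : Diff n M} (hφ : IsContactomorphism C φ) :
    IsContactomorphism C φ.symm := by
  intro p
  have key : ∀ q : M, (C.ξ (φ q)).map
      (mfderiv (𝓡 (2 * n + 1)) (𝓡 (2 * n + 1)) φ.symm (φ q)).toLinearMap = C.ξ q := by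
    intro q
    have h : (mfderiv (𝓡 (2 * n + 1)) (𝓡 (2 * n + 1)) φ.symm (φ q)).comp
        (mfderiv (𝓡 (2 * n + 1)) (𝓡 (2 * n + 1)) φ q) = ContinuousLinearMap.id ℝ _ := by
      rw [← mfderiv_comp q (φ.symm.mdifferentiable (by simp) _) (φ.mdifferentiable (by simp) _)]
      have : (φ.symm ∘ φ : M → M) = id := funext φ.symm_apply_apply
      rw [this]; exact mfderiv_id
    rw [← hφ q, ← Submodule.map_comp]
    have h' := congrArg ContinuousLinearMap.toLinearMap h
    exact (congrArg (fun L => Submodule.map L (C.ξ q)) h').trans (Submodule.map_id _)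
  have h3 := key (φ.symm p)
  rw [φ.apply_symm_apply] at h3
  exact h3

variable (C) in
/-- The constant isotopy at the identity. -/
def ContactIsotopy.refl : ContactIsotopy C where
  at' _ := Diffeomorph.refl (𝓡 (2 * n + 1)) M ∞
  contact _ _ := IsContactomorphism.refl
  smooth := contMDiffOn_snd

/-- The isotopy `ψ_t ∘ φ_t`. -/
def ContactIsotopy.comp (Ψ Φ : ContactIsotopy C) : ContactIsotopy C where
  at' t := (Φ.at' t).trans (Ψ.at' t)
  contact t ht := (Φ.contact t ht).trans (Ψ.contact t ht)
  smooth := Ψ.smooth.comp (contMDiffOn_fst.prodMk Φ.smooth) fun _ hx => ⟨hx.1, mem_univ _⟩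

/-- The isotopy `φ_{1-t} ∘ φ_1⁻¹`. -/
def ContactIsotopy.rev (Φ : ContactIsotopy C) : ContactIsotopy C where
  at' t := (Φ.at' 1).symm.trans (Φ.at' (1 - t))
  contact t ht := (Φ.contact 1 ⟨zero_le_one, le_rfl⟩).symm.trans
    (Φ.contact (1 - t) ⟨by linarith [ht.2], by linarith [ht.1]⟩)
  smooth := by
    have h1 : ContMDiff 𝓘(ℝ, ℝ) 𝓘(ℝ, ℝ) ∞ (fun t : ℝ => 1 - t) :=
      (contDiff_const.sub contDiff_id).contMDiff
    have h2 : ContMDiff ((𝓘(ℝ, ℝ)).prod (𝓡 (2 * n + 1))) ((𝓘(ℝ, ℝ)).prod (𝓡 (2 * n + 1))) ∞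
        (fun x : ℝ × M => (1 - x.1, (Φ.at' 1).symm x.2)) :=
      (h1.comp contMDiff_fst).prodMk ((Φ.at' 1).symm.contMDiff.comp contMDiff_snd)
    exact Φ.smooth.comp h2.contMDiffOn fun x hx =>
      ⟨⟨by linarith [hx.1.2], by linarith [hx.1.1]⟩, mem_univ _⟩

variable (C)

/-- `Cont₀(M)`: the diffeomorphisms that are isotopic to the identity through contactomorphisms. -/
def Cont₀ : Type _ :=
  {φ : Diff n M // ∃ Φ : ContactIsotopy C,
    Φ.at' 0 = Diffeomorph.refl (𝓡 (2 * n + 1)) M ∞ ∧ Φ.at' 1 = φ}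

variable {C}

/-- The group structure of `Cont₀(M)`, given by composition. -/
instance : Group (Cont₀ C) where
  mul φ ψ := ⟨ψ.1.trans φ.1, by
    obtain ⟨Φ, h0, h1⟩ := φ.2
    obtain ⟨Ψ, k0, k1⟩ := ψ.2
    exact ⟨Φ.comp Ψ, by simp [ContactIsotopy.comp, h0, k0], by simp [ContactIsotopy.comp, h1, k1]⟩⟩
  one := ⟨Diffeomorph.refl (𝓡 (2 * n + 1)) M ∞, ContactIsotopy.refl C, rfl, rfl⟩
  inv φ := ⟨φ.1.symm, by
    obtain ⟨Φ, h0, h1⟩ := φ.2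
    exact ⟨Φ.rev, by simp [ContactIsotopy.rev], by simp [ContactIsotopy.rev, h0, h1]⟩⟩
  mul_assoc _ _ _ := rfl
  one_mul _ := rfl
  mul_one _ := rfl
  inv_mul_cancel φ := Subtype.ext φ.1.self_trans_symm

/-- The norm `|φ|_α`: the infimum of `∫₀¹ max_M |α(X_t)| dt` over all isotopies of
contactomorphisms from the identity to `φ`. -/
def hoferNorm (α : ContactForm n M) (φ : Cont₀ C) : ℝ :=
  sInf {r : ℝ | ∃ Φ : ContactIsotopy C,
    Φ.at' 0 = (1 : Cont₀ C).1 ∧ Φ.at' 1 = φ.1 ∧ Φ.length α = r}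

/-- The distance `d_α(φ, ψ) = |ψ⁻¹ φ|_α`. -/
def hoferDist (α : ContactForm n M) (φ ψ : Cont₀ C) : ℝ := hoferNorm α (ψ⁻¹ * φ)

/-- The topology induced by `d_α`: a set is open if with each of its points it contains a
`d_α`-ball of positive radius around that point. -/
@[reducible] def hoferTopology (C : CoorientedContactStructure n M) (α : ContactForm n M) :
    TopologicalSpace (Cont₀ C) where
  IsOpen U := ∀ φ ∈ U, ∃ ε : ℝ, 0 < ε ∧ ∀ ψ : Cont₀ C, hoferDist α φ ψ < ε → ψ ∈ U
  isOpen_univ _ _ := ⟨1, one_pos, fun _ _ => mem_univ _⟩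
  isOpen_inter U V hU hV φ hφ := by
    obtain ⟨a, ha, hU'⟩ := hU φ hφ.1
    obtain ⟨b, hb, hV'⟩ := hV φ hφ.2
    exact ⟨min a b, lt_min ha hb, fun ψ hψ =>
      ⟨hU' ψ (hψ.trans_le (min_le_left _ _)), hV' ψ (hψ.trans_le (min_le_right _ _))⟩⟩
  isOpen_sUnion S hS φ hφ := by
    obtain ⟨U, hU, hφU⟩ := hφ
    obtain ⟨a, ha, hU'⟩ := hS U hU φ hφU
    exact ⟨a, ha, fun ψ hψ => ⟨U, hU, hU' ψ hψ⟩⟩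

/-- The chronological relation: there is a positive isotopy from `φ` to `ψ`. -/
def Chron (φ ψ : Cont₀ C) : Prop :=
  ∃ Φ : ContactIsotopy C, Φ.IsPositive ∧ Φ.at' 0 = φ.1 ∧ Φ.at' 1 = ψ.1

/-- The chronological future `I⁺(φ)`. -/
def chronFuture (φ : Cont₀ C) : Set (Cont₀ C) := {ψ | Chron φ ψ}

/-- The chronological past `I⁻(φ)`. -/
def chronPast (φ : Cont₀ C) : Set (Cont₀ C) := {ψ | Chron ψ φ}

/-- The interval topology, generated by the sets `I⁺(φ) ∩ I⁻(ψ)`. -/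
@[reducible] def intervalTopology (C : CoorientedContactStructure n M) : TopologicalSpace (Cont₀ C) :=
  TopologicalSpace.generateFrom {U | ∃ φ ψ : Cont₀ C, U = chronFuture φ ∩ chronPast ψ}

end Isotopies

end ContactGeom

end

noncomputable section

namespace ContactGeom

open Bundle

variable {n : ℕ} {M : Type*} [TopologicalSpace M] [ChartedSpace (Model n) M]

/-! ### Contact forms: continuity on the tangent bundle and nonvanishing. -/

section ContactForms

variable [IsManifold (𝓡 (2 * n + 1)) ∞ M]

/-! A positive isotopy `φ_t` of a compact manifold has room to spare: `α(X_t) ≥ δ > 0`, and since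
each `φ_t` preserves `ξ`, `φ_t^*α` is a multiple of `α` by a factor of absolute value at most `Λ`.
Compose it on the inside with an isotopy `ψ_t` with velocity `Y_t`, after a time change `τ`. By the
chain rule, `φ_{τ(t)} ∘ ψ_t` has `α`-velocity at least `τ'(t) δ - Λ k(t)`, where `k(t) = max
|α(Y_t)|`. A time change of `[0,1]` with `τ' > Λ k / δ` exists as soon as `∫ k < δ / Λ`, that is,
when `ψ_t` is short. This is `IsPositive.exists_comp_isPositive`, resting on
`exists_contDiff_reparametrization` and `exists_abs_form_mfderiv_le`.

The bound `δ / Λ` depends only on `φ_t`, so either endpoint of `φ_t` can be moved within a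
`d_α`-ball while the other stays fixed. The convention `d_α(φ, ψ) = |ψ⁻¹φ|_α` puts the correction on
the inside, so that only conformal factors of the fixed `φ_t` enter. -/

theorem ContactForm.continuous_apply (α : ContactForm n M) :
    Continuous (fun v : TangentBundle (𝓡 (2 * n + 1)) M => α.form v.1 v.2) := by
  have h1 : Continuous (fun p : M => TotalSpace.mk' (Model n →L[ℝ] ℝ)
      (E := fun p : M => TangentSpace (𝓡 (2 * n + 1)) p →L[ℝ] Bundle.Trivial M ℝ p) p (α.form p)) :=
    α.smooth.continuous
  have h2 : Continuous (fun v : TangentBundle (𝓡 (2 * n + 1)) M => v.1) :=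
    FiberBundle.continuous_proj _ _
  have h3 := Continuous.clm_bundle_apply (𝕜 := ℝ) (F₁ := Model n) (F₂ := ℝ)
    (E₁ := fun p : M => TangentSpace (𝓡 (2 * n + 1)) p) (E₂ := Bundle.Trivial M ℝ)
    (b := fun v : TangentBundle (𝓡 (2 * n + 1)) M => v.1) (ϕ := fun v => α.form v.1)
    (v := fun v => v.2) (h1.comp h2) continuous_id
  exact (Bundle.Trivial.homeomorphProd M ℝ).continuous.comp h3 |>.snd

theorem ContactForm.form_ne_zero (α : ContactForm n M) (p : M) : α.form p ≠ 0 := by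
  intro h
  obtain ⟨v, hv⟩ := α.nondegenerate p
  exact hv (by simp [contactVolume, h])

theorem ContactForm.exists_eq_one (α : ContactForm n M) (p : M) : ∃ v, α.form p v = 1 := by
  have h := α.form_ne_zero p
  obtain ⟨w, hw⟩ : ∃ w, α.form p w ≠ 0 := by
    by_contra! h'
    exact h (ContinuousLinearMap.ext h')
  exact ⟨(α.form p w)⁻¹ • w, by rw [map_smul, smul_eq_mul, inv_mul_cancel₀ hw]⟩

end ContactForms

/-! ### Derivatives of isotopies in time and space. -/

section Derivatives

/-- The inclusion of `ℝ × TM` into `T(ℝ × M)` with prescribed `ℝ`-component `s`. -/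
def timeLift (s : ℝ) (x : ℝ × TangentBundle (𝓡 (2 * n + 1)) M) :
    TangentBundle ((𝓘(ℝ, ℝ)).prod (𝓡 (2 * n + 1))) (ℝ × M) :=
  (equivTangentBundleProd 𝓘(ℝ, ℝ) ℝ (𝓡 (2 * n + 1)) M).symm (⟨x.1, s⟩, x.2)

theorem uniqueMDiffOn_Icc_prod_univ :
    UniqueMDiffOn ((𝓘(ℝ, ℝ)).prod (𝓡 (2 * n + 1))) (Icc (0 : ℝ) 1 ×ˢ (univ : Set M)) :=
  (uniqueDiffOn_Icc one_pos).uniqueMDiffOn.prod uniqueMDiffOn_univ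

theorem uniqueMDiffWithinAt_Icc {t : ℝ} (ht : t ∈ Icc (0 : ℝ) 1) :
    UniqueMDiffWithinAt 𝓘(ℝ, ℝ) (Icc (0 : ℝ) 1) t :=
  (uniqueDiffOn_Icc one_pos).uniqueMDiffOn t ht

variable [IsManifold (𝓡 (2 * n + 1)) ∞ M]

theorem continuous_timeLift (s : ℝ) : Continuous (timeLift (n := n) (M := M) s) := by
  have : IsManifold (𝓡 (2 * n + 1)) 1 M := IsManifold.of_le (n := ∞) (by simp)
  have h1 : Continuous (fun t : ℝ => (⟨t, s⟩ : TangentBundle 𝓘(ℝ, ℝ) ℝ)) :=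
    (tangentBundleModelSpaceHomeomorph 𝓘(ℝ, ℝ)).symm.continuous.comp
      (continuous_id.prodMk continuous_const)
  have h2 : Continuous (equivTangentBundleProd 𝓘(ℝ, ℝ) ℝ (𝓡 (2 * n + 1)) M).symm :=
    (contMDiff_equivTangentBundleProd_symm (n := 0)).continuous
  exact h2.comp ((h1.comp continuous_fst).prodMk continuous_snd)

variable {C : CoorientedContactStructure n M}

namespace ContactIsotopy

variable (Φ : ContactIsotopy C)

/-- The derivative of `(t, p) ↦ φ_t(p)` on `[0,1] × M`. -/
def totalDeriv (t : ℝ) (p : M) : ℝ × TangentSpace (𝓡 (2 * n + 1)) p →L[ℝ]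
    TangentSpace (𝓡 (2 * n + 1)) (Φ.at' t p) :=
  mfderivWithin ((𝓘(ℝ, ℝ)).prod (𝓡 (2 * n + 1))) (𝓡 (2 * n + 1))
    (fun x : ℝ × M => Φ.at' x.1 x.2) (Icc (0 : ℝ) 1 ×ˢ (univ : Set M)) (t, p)

theorem hasMFDerivWithinAt {t : ℝ} (ht : t ∈ Icc (0 : ℝ) 1) (p : M) :
    HasMFDerivWithinAt ((𝓘(ℝ, ℝ)).prod (𝓡 (2 * n + 1))) (𝓡 (2 * n + 1))
      (fun x : ℝ × M => Φ.at' x.1 x.2) (Icc (0 : ℝ) 1 ×ˢ (univ : Set M)) (t, p)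
      (Φ.totalDeriv t p) :=
  ((Φ.smooth.mdifferentiableOn (by simp)) (t, p) ⟨ht, mem_univ _⟩).hasMFDerivWithinAt

theorem hasMFDerivWithinAt_comp {t : ℝ} (ht : t ∈ Icc (0 : ℝ) 1)
    {τ : ℝ → ℝ} (hτ : MapsTo τ (Icc 0 1) (Icc 0 1)) {τ' : ℝ →L[ℝ] ℝ}
    (hτ' : HasMFDerivWithinAt 𝓘(ℝ, ℝ) 𝓘(ℝ, ℝ) τ (Icc 0 1) t τ')
    {c : ℝ → M} {c' : ℝ →L[ℝ] TangentSpace (𝓡 (2 * n + 1)) (c t)}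
    (hc : HasMFDerivWithinAt 𝓘(ℝ, ℝ) (𝓡 (2 * n + 1)) c (Icc 0 1) t c') :
    HasMFDerivWithinAt 𝓘(ℝ, ℝ) (𝓡 (2 * n + 1)) (fun s => Φ.at' (τ s) (c s)) (Icc 0 1) t
      ((Φ.totalDeriv (τ t) (c t)).comp (τ'.prod c')) :=
  HasMFDerivWithinAt.comp (u := Icc (0 : ℝ) 1 ×ˢ (univ : Set M))
    (g := fun x : ℝ × M => Φ.at' x.1 x.2) t
    (Φ.hasMFDerivWithinAt (hτ ht) (c t)) (hτ'.prodMk hc) fun _ hs => ⟨hτ hs, mem_univ _⟩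

theorem velocity_hasMFDerivWithinAt {t : ℝ} (ht : t ∈ Icc (0 : ℝ) 1) (p : M) :
    HasMFDerivWithinAt 𝓘(ℝ, ℝ) (𝓡 (2 * n + 1)) (fun s : ℝ => Φ.at' s p) (Icc 0 1) t
      ((Φ.totalDeriv t p).comp ((ContinuousLinearMap.id ℝ ℝ).prod 0)) :=
  Φ.hasMFDerivWithinAt_comp ht (τ := id) (fun _ h => h) (hasMFDerivWithinAt_id _ _)
    (c := fun _ => p) (hasMFDerivWithinAt_const _ _ _)

theorem velocity_eq {t : ℝ} (ht : t ∈ Icc (0 : ℝ) 1) (p : M) :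
    Φ.velocity t p = Φ.totalDeriv t p (1, 0) := by
  rw [velocity, (Φ.velocity_hasMFDerivWithinAt ht p).mfderivWithin (uniqueMDiffWithinAt_Icc ht)]
  rfl

theorem mfderiv_at'_apply {t : ℝ} (ht : t ∈ Icc (0 : ℝ) 1) (p : M)
    (v : TangentSpace (𝓡 (2 * n + 1)) p) :
    mfderiv (𝓡 (2 * n + 1)) (𝓡 (2 * n + 1)) (Φ.at' t) p v = Φ.totalDeriv t p (0, v) := by
  have h : HasMFDerivWithinAt (𝓡 (2 * n + 1)) (𝓡 (2 * n + 1))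
      (fun q : M => Φ.at' t q) univ p
      ((Φ.totalDeriv t p).comp ((0 : TangentSpace (𝓡 (2 * n + 1)) p →L[ℝ] ℝ).prod
        (ContinuousLinearMap.id ℝ _))) :=
    HasMFDerivWithinAt.comp (u := Icc (0 : ℝ) 1 ×ˢ (univ : Set M))
    (g := fun x : ℝ × M => Φ.at' x.1 x.2)
      (f := fun q : M => (t, q)) p (Φ.hasMFDerivWithinAt ht p)
      ((hasMFDerivWithinAt_const (t : ℝ) univ p).prodMk (hasMFDerivWithinAt_id univ p))
      fun _ _ => ⟨ht, mem_univ _⟩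
  have h' := (hasMFDerivWithinAt_univ.1 h).mfderiv
  exact congrArg (fun L => L v) h'

/-- Chain rule for `t ↦ φ_{τ(t)}(c(t))`. -/
theorem mfderivWithin_comp_apply {t : ℝ} (ht : t ∈ Icc (0 : ℝ) 1)
    {τ : ℝ → ℝ} (hτ : MapsTo τ (Icc 0 1) (Icc 0 1)) {τ' : ℝ} (hτ' : HasDerivAt τ τ' t)
    {c : ℝ → M} (hc : MDifferentiableWithinAt 𝓘(ℝ, ℝ) (𝓡 (2 * n + 1)) c (Icc 0 1) t) :
    mfderivWithin 𝓘(ℝ, ℝ) (𝓡 (2 * n + 1)) (fun s => Φ.at' (τ s) (c s)) (Icc 0 1) t (1 : ℝ) =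
      τ' • Φ.velocity (τ t) (c t) +
        mfderiv (𝓡 (2 * n + 1)) (𝓡 (2 * n + 1)) (Φ.at' (τ t)) (c t)
          (mfderivWithin 𝓘(ℝ, ℝ) (𝓡 (2 * n + 1)) c (Icc 0 1) t (1 : ℝ)) := by
  have h := (Φ.hasMFDerivWithinAt_comp ht hτ
    hτ'.hasFDerivAt.hasFDerivWithinAt.hasMFDerivWithinAt
    hc.hasMFDerivWithinAt).mfderivWithin (uniqueMDiffWithinAt_Icc ht)
  rw [h, Φ.velocity_eq (hτ ht), Φ.mfderiv_at'_apply (hτ ht), ← map_smul, ← map_add]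
  refine congrArg (Φ.totalDeriv (τ t) (c t)) ?_
  refine Prod.ext ?_ ?_
  · exact (one_mul τ').trans (by simp)
  · simp
    rfl

/-- One joint continuity statement serves twice: `s = 1` on the zero section gives the velocity, `s
= 0` gives the spatial differential. -/
theorem continuousOn_form_totalDeriv (α : ContactForm n M) (s : ℝ) :
    ContinuousOn (fun x : ℝ × TangentBundle (𝓡 (2 * n + 1)) M =>
      α.form (Φ.at' x.1 x.2.1) (Φ.totalDeriv x.1 x.2.1 (s, x.2.2))) (Icc 0 1 ×ˢ univ) := by
  have h1 := Φ.smooth.continuousOn_tangentMapWithin (by simp) uniqueMDiffOn_Icc_prod_univ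
  have h2 := α.continuous_apply.comp_continuousOn
    (h1.comp (continuous_timeLift s).continuousOn (s := Icc 0 1 ×ˢ univ) fun x hx =>
      (⟨hx.1, mem_univ _⟩ : (x.1, x.2.1) ∈ Icc (0 : ℝ) 1 ×ˢ (univ : Set M)))
  exact h2

theorem continuousOn_form_velocity (α : ContactForm n M) :
    ContinuousOn (fun x : ℝ × M => α.form (Φ.at' x.1 x.2) (Φ.velocity x.1 x.2))
      (Icc 0 1 ×ˢ univ) := by
  have h0 : Continuous (fun x : ℝ × M => (x.1, zeroSection (Model n)
      (TangentSpace (𝓡 (2 * n + 1)) : M → Type _) x.2)) :=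
    continuous_fst.prodMk ((Bundle.Trivialization.continuous_zeroSection ℝ).comp continuous_snd)
  refine ((Φ.continuousOn_form_totalDeriv α 1).comp h0.continuousOn
    (s := Icc 0 1 ×ˢ univ) fun x hx => ⟨hx.1, mem_univ _⟩).congr fun x hx => ?_
  exact congrArg (α.form _) (Φ.velocity_eq hx.1 x.2)

theorem continuousOn_form_mfderiv (α : ContactForm n M) :
    ContinuousOn (fun x : ℝ × TangentBundle (𝓡 (2 * n + 1)) M =>
      α.form (Φ.at' x.1 x.2.1)
        (mfderiv (𝓡 (2 * n + 1)) (𝓡 (2 * n + 1)) (Φ.at' x.1) x.2.1 x.2.2))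
      (Icc 0 1 ×ˢ univ) :=
  (Φ.continuousOn_form_totalDeriv α 0).congr fun x hx =>
    congrArg (α.form _) (Φ.mfderiv_at'_apply hx.1 x.2.1 x.2.2)

end ContactIsotopy

end Derivatives

/-! ### Time changes with prescribed lower bound on the speed. -/

/-- If `k` is continuous with integral less than `1`, there is a smooth
reparametrization `τ` of `[0,1]` whose derivative `q` is larger than `k`. -/
theorem exists_contDiff_reparametrization {k : ℝ → ℝ} (hk : ContinuousOn k (Icc 0 1))
    (hk0 : ∀ t ∈ Icc (0 : ℝ) 1, 0 ≤ k t) (hint : ∫ t in (0 : ℝ)..1, k t < 1) :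
    ∃ τ q : ℝ → ℝ, ContDiff ℝ ∞ τ ∧ (∀ t, HasDerivAt τ (q t) t) ∧ τ 0 = 0 ∧ τ 1 = 1 ∧
      MapsTo τ (Icc 0 1) (Icc 0 1) ∧ ∀ t ∈ Icc (0 : ℝ) 1, k t < q t := by
  -- One `e` pays for `P > k - e`, the other for `∫ P ≤ ∫ k + e`. Together they give `r > e`, hence
  -- `P + r > k`.
  obtain ⟨e, he, hee⟩ : ∃ e : ℝ, 0 < e ∧ 2 * e < 1 - ∫ t in (0 : ℝ)..1, k t :=
    ⟨(1 - ∫ t in (0 : ℝ)..1, k t) / 4, by linarith, by linarith⟩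
  -- Weierstrass approximation makes the speed smooth although `k` is only continuous; the constant
  -- `r` normalizes its integral to `1`.
  obtain ⟨P, hP⟩ := exists_polynomial_near_of_continuousOn 0 1 k hk e he
  set r : ℝ := 1 - ∫ t in (0 : ℝ)..1, P.eval t with hr
  set q : ℝ → ℝ := fun t => P.eval t + r with hq
  have hPi : ∫ t in (0 : ℝ)..1, P.eval t ≤ (∫ t in (0 : ℝ)..1, k t) + e := by
    have hki : IntervalIntegrable k volume 0 1 :=
      ContinuousOn.intervalIntegrable (by rwa [uIcc_of_le zero_le_one])
    have : ∫ t in (0 : ℝ)..1, P.eval t ≤ ∫ t in (0 : ℝ)..1, (k t + e) :=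
      intervalIntegral.integral_mono_on zero_le_one (P.continuous.intervalIntegrable _ _)
        (hki.add intervalIntegrable_const) fun t ht => by linarith [(abs_lt.1 (hP t ht)).2]
    rw [intervalIntegral.integral_add hki intervalIntegrable_const] at this
    simpa using this
  have hqc : ContDiff ℝ ∞ q := (by simpa [Polynomial.coe_aeval_eq_eval] using P.contDiff_aeval (𝕜 := ℝ) ∞ : ContDiff ℝ ∞ (fun t => P.eval t)).add contDiff_const
  have hkq : ∀ t ∈ Icc (0 : ℝ) 1, k t < q t := fun t ht => by
    have := (abs_lt.1 (hP t ht)).1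
    simp only [hq]
    linarith
  have hd : ∀ t, HasDerivAt (fun u => ∫ s in (0 : ℝ)..u, q s) (q t) t := fun t =>
    intervalIntegral.integral_hasDerivAt_right (hqc.continuous.intervalIntegrable _ _)
      (hqc.continuous.stronglyMeasurableAtFilter _ _) hqc.continuous.continuousAt
  have h1 : ∫ s in (0 : ℝ)..1, q s = 1 := by
    simp only [hq]
    rw [intervalIntegral.integral_add (P.continuous.intervalIntegrable _ _)
      intervalIntegrable_const]
    simp [hr]
  have hmono : MonotoneOn (fun u => ∫ s in (0 : ℝ)..u, q s) (Icc 0 1) :=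
    monotoneOn_of_deriv_nonneg (convex_Icc 0 1)
      (fun t _ => (hd t).continuousAt.continuousWithinAt)
      (fun t _ => (hd t).differentiableAt.differentiableWithinAt) fun t ht => by
        rw [(hd t).deriv]
        rw [interior_Icc] at ht
        exact (hk0 t (Ioo_subset_Icc_self ht)).trans (hkq t (Ioo_subset_Icc_self ht)).le
  refine ⟨fun u => ∫ s in (0 : ℝ)..u, q s, q, ?_, hd, by simp, h1, fun t ht => ⟨?_, ?_⟩, hkq⟩
  · rw [contDiff_infty_iff_deriv]
    refine ⟨fun t => (hd t).differentiableAt, ?_⟩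
    rwa [show deriv (fun u => ∫ s in (0 : ℝ)..u, q s) = q from funext fun t => (hd t).deriv]
  · simpa using hmono (left_mem_Icc.2 zero_le_one) ht ht.1
  · simpa [h1] using hmono ht (right_mem_Icc.2 zero_le_one) ht.2

variable [IsManifold (𝓡 (2 * n + 1)) ∞ M] {C : CoorientedContactStructure n M}

/-! ### Conformal factors, uniform bounds and perturbation of positive isotopies. -/

namespace ContactIsotopy

variable (Φ : ContactIsotopy C)

theorem form_mfderiv_eq_zero {α : ContactForm n M} (hα : α.Defines C) {t : ℝ}
    (ht : t ∈ Icc (0 : ℝ) 1) {p : M} {v : TangentSpace (𝓡 (2 * n + 1)) p} (hv : α.form p v = 0) :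
    α.form (Φ.at' t p) (mfderiv (𝓡 (2 * n + 1)) (𝓡 (2 * n + 1)) (Φ.at' t) p v) = 0 := by
  rw [← (hα _ _).1, ← Φ.contact t ht p]
  exact Submodule.mem_map_of_mem ((hα p v).1.2 hv)

/-- Both `α` and its pullback under `φ_t` vanish on `ξ`, so their ratio can be read off on a single
local vector field transverse to `ξ`, where continuity bounds it. -/
theorem exists_eventually_abs_form_mfderiv_le {α : ContactForm n M} (hα : α.Defines C)
    {t₀ : ℝ} (ht₀ : t₀ ∈ Icc (0 : ℝ) 1) (p₀ : M) :
    ∃ Λ : ℝ, ∀ᶠ x : ℝ × M in 𝓝[Icc (0 : ℝ) 1 ×ˢ univ] (t₀, p₀),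
      ∀ v : TangentSpace (𝓡 (2 * n + 1)) x.2,
        |α.form (Φ.at' x.1 x.2) (mfderiv (𝓡 (2 * n + 1)) (𝓡 (2 * n + 1)) (Φ.at' x.1) x.2 v)| ≤
          Λ * |α.form x.2 v| := by
  obtain ⟨v₀, hv₀⟩ := α.exists_eq_one p₀
  -- Continuity of `V` at `p₀` alone suffices, since only an eventual estimate is sought.
  let V : ∀ p : M, TangentSpace (𝓡 (2 * n + 1)) p := FiberBundle.extend (Model n) v₀
  have hV₀ : V p₀ = v₀ := FiberBundle.extend_apply_self _ _
  have hV : ContinuousAt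
      (fun p => (⟨p, V p⟩ : TangentBundle (𝓡 (2 * n + 1)) M)) p₀ :=
    (FiberBundle.mdifferentiableAt_extend (𝓡 (2 * n + 1)) (Model n) v₀).continuousAt
  have hV2 : ContinuousWithinAt
      (fun x : ℝ × M => ((x.1, ⟨x.2, V x.2⟩) : ℝ × TangentBundle (𝓡 (2 * n + 1)) M))
      (Icc (0 : ℝ) 1 ×ˢ univ) (t₀, p₀) :=
    (continuousAt_fst.prodMk
      (ContinuousAt.comp (x := ((t₀, p₀) : ℝ × M)) hV continuousAt_snd)).continuousWithinAt
  have hα1 : ContinuousWithinAt (fun x : ℝ × M => α.form x.2 (V x.2))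
      (Icc (0 : ℝ) 1 ×ˢ univ) (t₀, p₀) :=
    (α.continuous_apply.comp continuous_snd).continuousAt.comp_continuousWithinAt hV2
  have hα2 : ContinuousWithinAt (fun x : ℝ × M => α.form (Φ.at' x.1 x.2)
      (mfderiv (𝓡 (2 * n + 1)) (𝓡 (2 * n + 1)) (Φ.at' x.1) x.2 (V x.2)))
      (Icc (0 : ℝ) 1 ×ˢ univ) (t₀, p₀) :=
    ContinuousWithinAt.comp (x := ((t₀, p₀) : ℝ × M)) (t := Icc (0 : ℝ) 1 ×ˢ univ)
      (f := fun x : ℝ × M => ((x.1, ⟨x.2, V x.2⟩) : ℝ × TangentBundle (𝓡 (2 * n + 1)) M))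
      (Φ.continuousOn_form_mfderiv α (t₀, ⟨p₀, V p₀⟩) ⟨ht₀, mem_univ _⟩) hV2
      fun x hx => ⟨hx.1, mem_univ _⟩
  have e1 : ∀ᶠ x : ℝ × M in 𝓝[Icc (0 : ℝ) 1 ×ˢ univ] (t₀, p₀), 1 / 2 < α.form x.2 (V x.2) :=
    hα1.eventually_const_lt (by simp only [hV₀, hv₀]; norm_num)
  set K := |α.form (Φ.at' t₀ p₀)
    (mfderiv (𝓡 (2 * n + 1)) (𝓡 (2 * n + 1)) (Φ.at' t₀) p₀ (V p₀))| + 1 with hK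
  have e2 := hα2.abs.eventually_lt_const (u := K) (by simp [hK])
  -- Nearby, `α(V) > 1/2` and the pullback of `α` on `V` is below `K` in absolute value, so the
  -- ratio is at most `2K`.
  refine ⟨2 * K, ?_⟩
  filter_upwards [e1, e2, self_mem_nhdsWithin] with x h1 h2 hx v
  set D := mfderiv (𝓡 (2 * n + 1)) (𝓡 (2 * n + 1)) (Φ.at' x.1) x.2
  set a := α.form x.2 v
  set b := α.form x.2 (V x.2)
  have hb : 0 < b := by linarith
  -- Modulo `ξ`, `v` is a multiple of `V`.
  have hker : α.form x.2 (v - (a / b) • V x.2) = 0 := by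
    rw [map_sub, map_smul, smul_eq_mul]
    exact sub_eq_zero.2 (div_mul_cancel₀ a hb.ne').symm
  have h0 := Φ.form_mfderiv_eq_zero hα hx.1 hker
  rw [map_sub, map_sub, map_smul, map_smul, smul_eq_mul, sub_eq_zero] at h0
  rw [h0, abs_mul, abs_div, abs_of_pos hb]
  have h3 : |a| / b ≤ 2 * |a| := by
    rw [div_le_iff₀ hb]
    nlinarith [abs_nonneg a]
  calc |a| / b * _ ≤ (2 * |a|) * K := by gcongr
    _ = 2 * K * |a| := by ring

/-- The conformal factors of a contact isotopy of a compact manifold are bounded. -/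
theorem exists_abs_form_mfderiv_le [CompactSpace M] {α : ContactForm n M} (hα : α.Defines C) :
    ∃ Λ : ℝ, 0 < Λ ∧ ∀ t ∈ Icc (0 : ℝ) 1, ∀ (p : M) (v : TangentSpace (𝓡 (2 * n + 1)) p),
      |α.form (Φ.at' t p) (mfderiv (𝓡 (2 * n + 1)) (𝓡 (2 * n + 1)) (Φ.at' t) p v)| ≤
        Λ * |α.form p v| := by
  have h : ∃ Λ : ℝ, ∀ x ∈ Icc (0 : ℝ) 1 ×ˢ (univ : Set M),
      ∀ v : TangentSpace (𝓡 (2 * n + 1)) x.2,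
        |α.form (Φ.at' x.1 x.2) (mfderiv (𝓡 (2 * n + 1)) (𝓡 (2 * n + 1)) (Φ.at' x.1) x.2 v)| ≤
          Λ * |α.form x.2 v| := by
    -- Having some bound `Λ` passes to subsets and finite unions, so the local bounds suffice by
    -- compactness.
    refine (isCompact_Icc.prod isCompact_univ).induction_on
      (p := fun s : Set (ℝ × M) => ∃ Λ : ℝ, ∀ x ∈ s, ∀ v : TangentSpace (𝓡 (2 * n + 1)) x.2,
        |α.form (Φ.at' x.1 x.2) (mfderiv (𝓡 (2 * n + 1)) (𝓡 (2 * n + 1)) (Φ.at' x.1) x.2 v)| ≤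
          Λ * |α.form x.2 v|) ⟨0, by simp⟩
      (fun s t hst ⟨Λ, hΛ⟩ => ⟨Λ, fun x hx => hΛ x (hst hx)⟩) ?_ ?_
    · rintro s t ⟨A, hA⟩ ⟨B, hB⟩
      refine ⟨max A B, fun x hx v => ?_⟩
      rcases hx with hx | hx
      · exact (hA x hx v).trans (by gcongr; exact le_max_left _ _)
      · exact (hB x hx v).trans (by gcongr; exact le_max_right _ _)
    · rintro ⟨t, p⟩ hx
      obtain ⟨Λ, hΛ⟩ := Φ.exists_eventually_abs_form_mfderiv_le hα hx.1 p
      exact ⟨_, hΛ, Λ, fun x hx => hx⟩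
  obtain ⟨Λ, hΛ⟩ := h
  refine ⟨max Λ 1, by positivity, fun t ht p v => (hΛ (t, p) ⟨ht, mem_univ _⟩ v).trans ?_⟩
  dsimp only
  gcongr
  exact le_max_left _ _

theorem IsPositive.exists_le_form_velocity [CompactSpace M] {Φ : ContactIsotopy C}
    (hΦ : Φ.IsPositive) {α : ContactForm n M} (hα : α.Defines C) :
    ∃ δ : ℝ, 0 < δ ∧ ∀ t ∈ Icc (0 : ℝ) 1, ∀ p : M, δ ≤ α.form (Φ.at' t p) (Φ.velocity t p) := by
  -- The minimum over `[0,1] × M` is attained only if `M` is nonempty; otherwise any `δ` works.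
  rcases isEmpty_or_nonempty M with hM | ⟨⟨p₀⟩⟩
  · exact ⟨1, one_pos, fun _ _ p => hM.elim p⟩
  obtain ⟨x, hx, hmin⟩ := (isCompact_Icc.prod isCompact_univ).exists_isMinOn
    ⟨(0, p₀), left_mem_Icc.2 zero_le_one, mem_univ _⟩ (Φ.continuousOn_form_velocity α)
  exact ⟨_, (hα _ _).2.1 (hΦ x.1 hx.1 x.2), fun t ht p => hmin (a := (t, p)) ⟨ht, mem_univ _⟩⟩

/-- Compactness of `M` makes the supremum depend continuously on `t`. The integrand of the length
can then serve as the lower bound for the speed of a time change. -/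
theorem continuousOn_iSup_abs_form_velocity [CompactSpace M] (α : ContactForm n M) :
    ContinuousOn (fun t => ⨆ p : M, |α.form (Φ.at' t p) (Φ.velocity t p)|) (Icc 0 1) := by
  rw [continuousOn_iff_continuous_domRestrict]
  have h : Continuous (fun x : Icc (0 : ℝ) 1 × M =>
      |α.form (Φ.at' x.1 x.2) (Φ.velocity x.1 x.2)|) :=
    ((Φ.continuousOn_form_velocity α).comp_continuous
      (f := fun x : Icc (0 : ℝ) 1 × M => ((x.1 : ℝ), x.2)) (by fun_prop)
      fun x => ⟨x.1.2, mem_univ _⟩).abs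
  have h2 := (isCompact_univ (X := M)).continuous_sSup
    (f := fun (t : Icc (0 : ℝ) 1) (p : M) => |α.form (Φ.at' t p) (Φ.velocity t p)|) h
  simp only [image_univ] at h2
  exact h2

theorem abs_form_velocity_le_iSup [CompactSpace M] (α : ContactForm n M) {t : ℝ}
    (ht : t ∈ Icc (0 : ℝ) 1) (p : M) :
    |α.form (Φ.at' t p) (Φ.velocity t p)| ≤ ⨆ p : M, |α.form (Φ.at' t p) (Φ.velocity t p)| := by
  refine le_ciSup (f := fun p : M => |α.form (Φ.at' t p) (Φ.velocity t p)|) ?_ p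
  have h : Continuous (fun p : M => |α.form (Φ.at' t p) (Φ.velocity t p)|) :=
    ((Φ.continuousOn_form_velocity α).comp_continuous
      (f := fun p : M => (t, p)) (by fun_prop) fun p => ⟨ht, mem_univ _⟩).abs
  exact (isCompact_range h).bddAbove

theorem mdifferentiableWithinAt_apply {t : ℝ} (ht : t ∈ Icc (0 : ℝ) 1) (p : M) :
    MDifferentiableWithinAt 𝓘(ℝ, ℝ) (𝓡 (2 * n + 1)) (fun s => Φ.at' s p) (Icc 0 1) t :=
  (Φ.velocity_hasMFDerivWithinAt ht p).mdifferentiableWithinAt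

/-- The isotopy `φ_{τ(t)}`. -/
def reparam (τ : ℝ → ℝ) (hτ : ContDiff ℝ ∞ τ) (hτ01 : MapsTo τ (Icc 0 1) (Icc 0 1)) :
    ContactIsotopy C where
  at' t := Φ.at' (τ t)
  contact t ht := Φ.contact (τ t) (hτ01 ht)
  smooth := Φ.smooth.comp ((hτ.contMDiff.comp contMDiff_fst).prodMk contMDiff_snd).contMDiffOn
    fun _ hx => ⟨hτ01 hx.1, mem_univ _⟩

theorem velocity_reparam_comp {τ : ℝ → ℝ} (hτ : ContDiff ℝ ∞ τ)
    (hτ01 : MapsTo τ (Icc 0 1) (Icc 0 1)) {τ' t : ℝ} (hτ' : HasDerivAt τ τ' t)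
    (ht : t ∈ Icc (0 : ℝ) 1) (Ψ : ContactIsotopy C) (p : M) :
    ((Φ.reparam τ hτ hτ01).comp Ψ).velocity t p =
      τ' • Φ.velocity (τ t) (Ψ.at' t p) +
        mfderiv (𝓡 (2 * n + 1)) (𝓡 (2 * n + 1)) (Φ.at' (τ t)) (Ψ.at' t p) (Ψ.velocity t p) :=
  Φ.mfderivWithin_comp_apply ht hτ01 hτ' (Ψ.mdifferentiableWithinAt_apply ht p)

/-- A positive isotopy stays positive, after a reparametrization, when it is composed with a
sufficiently short isotopy. -/
theorem IsPositive.exists_comp_isPositive [CompactSpace M] {Φ : ContactIsotopy C}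
    (hΦ : Φ.IsPositive) {α : ContactForm n M} (hα : α.Defines C) :
    ∃ ε : ℝ, 0 < ε ∧ ∀ Ψ : ContactIsotopy C, Ψ.length α < ε → ∃ Θ : ContactIsotopy C,
      Θ.IsPositive ∧ Θ.at' 0 = (Ψ.at' 0).trans (Φ.at' 0) ∧
        Θ.at' 1 = (Ψ.at' 1).trans (Φ.at' 1) := by
  obtain ⟨δ, hδ, hδΦ⟩ := hΦ.exists_le_form_velocity hα
  obtain ⟨Λ, hΛ, hΛΦ⟩ := Φ.exists_abs_form_mfderiv_le hα
  -- Exactly the threshold at which `Λ / δ * k` has integral below `1`.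
  refine ⟨δ / Λ, by positivity, fun Ψ hΨ => ?_⟩
  set k : ℝ → ℝ := fun t => ⨆ p : M, |α.form (Ψ.at' t p) (Ψ.velocity t p)| with hk
  have hk0 : ∀ t, 0 ≤ k t := fun t => Real.iSup_nonneg fun p => abs_nonneg _
  have hint : ∫ t in (0 : ℝ)..1, Λ / δ * k t < 1 := by
    rw [intervalIntegral.integral_const_mul]
    calc Λ / δ * ∫ t in (0 : ℝ)..1, k t < Λ / δ * (δ / Λ) := by
          gcongr
          exact hΨ
      _ = 1 := by field_simp
  obtain ⟨τ, q, hτ, hq, h0, h1, hτ01, hkq⟩ := exists_contDiff_reparametrization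
    ((Ψ.continuousOn_iSup_abs_form_velocity α).const_mul (Λ / δ))
    (fun t _ => by have := hk0 t; positivity) hint
  refine ⟨(Φ.reparam τ hτ hτ01).comp Ψ, fun t ht p => ?_, by simp [comp, reparam, h0],
    by simp [comp, reparam, h1]⟩
  rw [(hα _ _).2, Φ.velocity_reparam_comp hτ hτ01 (hq t) ht]
  -- The first term of the velocity contributes at least `q t * δ`, the second at least `-Λ * k t`.
  have e1 := hδΦ (τ t) (hτ01 ht) (Ψ.at' t p)
  have e2 := hΛΦ (τ t) (hτ01 ht) (Ψ.at' t p) (Ψ.velocity t p)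
  have e3 := Ψ.abs_form_velocity_le_iSup α ht p
  have e4 : Λ * k t < q t * δ := by
    have := hkq t ht
    rwa [div_mul_eq_mul_div, div_lt_iff₀ hδ] at this
  have hq0 : 0 ≤ q t := (mul_nonneg (by positivity) (hk0 t)).trans (hkq t ht).le
  have e5 := (abs_le.1 e2).1
  have e6 := mul_le_mul_of_nonneg_left e3 hΛ.le
  have e7 := mul_le_mul_of_nonneg_left e1 hq0
  change 0 < α.form (Φ.at' (τ t) (Ψ.at' t p)) _
  rw [map_add, map_smul, smul_eq_mul]
  linarith

/-- The isotopy `φ_t ∘ ψ`. -/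
def precomp {ψ : Diff n M} (hψ : IsContactomorphism C ψ) : ContactIsotopy C where
  at' t := ψ.trans (Φ.at' t)
  contact t ht := hψ.trans (Φ.contact t ht)
  smooth := Φ.smooth.comp
    (contMDiff_fst.prodMk (ψ.contMDiff.comp contMDiff_snd)).contMDiffOn fun _ hx =>
      ⟨hx.1, mem_univ _⟩

/-- The velocity at `p` is that of `φ_t` at `ψ(p)`, and `ψ` only permutes the points over which the
supremum runs. -/
theorem length_precomp {ψ : Diff n M} (hψ : IsContactomorphism C ψ) (α : ContactForm n M) :
    (Φ.precomp hψ).length α = Φ.length α :=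
  intervalIntegral.integral_congr fun t _ =>
    ψ.toEquiv.iSup_comp (g := fun p : M => |α.form (Φ.at' t p) (Φ.velocity t p)|)

theorem velocity_rev {t : ℝ} (ht : t ∈ Icc (0 : ℝ) 1) (p : M) :
    Φ.rev.velocity t p = -Φ.velocity (1 - t) ((Φ.at' 1).symm p) := by
  have h := Φ.mfderivWithin_comp_apply ht (τ := fun t => 1 - t) (τ' := -1)
    (fun s hs => ⟨by linarith [hs.2], by linarith [hs.1]⟩)
    (by simpa using (hasDerivAt_id t).const_sub 1)
    (c := fun _ => (Φ.at' 1).symm p) mdifferentiableWithinAt_const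
  refine h.trans ?_
  rw [mfderivWithin_const, neg_one_smul]
  exact (congrArg _ (map_zero _)).trans (add_zero _)

/-- Reversal changes the sign of the velocity, permutes the points of `M` and substitutes `1 - t`
for `t`; none of this affects the integral. -/
theorem length_rev (α : ContactForm n M) : Φ.rev.length α = Φ.length α := by
  set k : ℝ → ℝ := fun t => ⨆ p : M, |α.form (Φ.at' t p) (Φ.velocity t p)| with hk
  have h : Φ.rev.length α = ∫ t in (0 : ℝ)..1, k (1 - t) := by
    refine intervalIntegral.integral_congr fun t ht => ?_
    rw [uIcc_of_le zero_le_one] at ht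
    refine Eq.trans ?_ ((Φ.at' 1).symm.toEquiv.iSup_comp
      (g := fun p : M => |α.form (Φ.at' (1 - t) p) (Φ.velocity (1 - t) p)|))
    refine iSup_congr fun p => ?_
    rw [Φ.velocity_rev ht]
    change |α.form (Φ.at' (1 - t) ((Φ.at' 1).symm p)) _| = _
    rw [map_neg, abs_neg]
    rfl
  rw [h, intervalIntegral.integral_comp_sub_left (fun t => k t) 1]
  simp [length, hk]

end ContactIsotopy

/-! ### Openness of chronological futures and pasts. -/

theorem exists_length_lt_of_hoferDist_lt {α : ContactForm n M} {φ ψ : Cont₀ C} {ε : ℝ}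
    (h : hoferDist α φ ψ < ε) : ∃ Φ : ContactIsotopy C,
      Φ.at' 0 = Diffeomorph.refl (𝓡 (2 * n + 1)) M ∞ ∧ Φ.at' 1 = φ.1.trans ψ.1.symm ∧
        Φ.length α < ε := by
  -- Membership in `Cont₀` supplies an isotopy, so the infimum is over a nonempty set and not the
  -- default value `0`.
  obtain ⟨Φ₀, h0, h1⟩ := (ψ⁻¹ * φ).2
  obtain ⟨r, ⟨Φ, k0, k1, rfl⟩, hr⟩ := exists_lt_of_csInf_lt
    (s := {r : ℝ | ∃ Φ : ContactIsotopy C,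
      Φ.at' 0 = (1 : Cont₀ C).1 ∧ Φ.at' 1 = (ψ⁻¹ * φ).1 ∧ Φ.length α = r})
    ⟨_, Φ₀, h0, h1, rfl⟩ h
  exact ⟨Φ, k0, k1, hr⟩

/-- For `η` near `ψ`, a short isotopy runs from the identity to `η⁻¹ψ`. Its reversal runs from the
identity to `ψ⁻¹η`, so inserting it keeps the start `φ` and moves the end from `ψ` to `ψψ⁻¹η = η`.
-/
theorem isOpen_chronFuture [CompactSpace M] {α : ContactForm n M} (hα : α.Defines C)
    (φ : Cont₀ C) : IsOpen[hoferTopology C α] (chronFuture φ) := by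
  rintro ψ ⟨Φ, hΦ, h0, h1⟩
  obtain ⟨ε, hε, H⟩ := hΦ.exists_comp_isPositive hα
  refine ⟨ε, hε, fun η hη => ?_⟩
  obtain ⟨Ψ, k0, k1, hΨ⟩ := exists_length_lt_of_hoferDist_lt hη
  obtain ⟨Θ, hΘ, e0, e1⟩ := H Ψ.rev (by rwa [Ψ.length_rev])
  refine ⟨Θ, hΘ, ?_, ?_⟩
  · rw [e0, h0]
    ext p
    simp [ContactIsotopy.rev]
  · rw [e1, h1]
    ext p
    simp [ContactIsotopy.rev, k0, k1]
    rfl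

/-- Here the start must move, so the short isotopy is translated instead of reversed: precomposed
with the inverse of its endpoint, it runs from `ψ⁻¹η` to the identity. -/
theorem isOpen_chronPast [CompactSpace M] {α : ContactForm n M} (hα : α.Defines C)
    (φ : Cont₀ C) : IsOpen[hoferTopology C α] (chronPast φ) := by
  rintro ψ ⟨Φ, hΦ, h0, h1⟩
  obtain ⟨ε, hε, H⟩ := hΦ.exists_comp_isPositive hα
  refine ⟨ε, hε, fun η hη => ?_⟩
  obtain ⟨Ψ, k0, k1, hΨ⟩ := exists_length_lt_of_hoferDist_lt hη
  obtain ⟨Θ, hΘ, e0, e1⟩ := H (Ψ.precomp (Ψ.contact 1 (right_mem_Icc.2 zero_le_one)).symm)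
    (by rwa [Ψ.length_precomp])
  refine ⟨Θ, hΘ, ?_, ?_⟩
  · rw [e0, h0]
    ext p
    simp [ContactIsotopy.precomp, k0, k1]
    rfl
  · rw [e1, h1]
    ext p
    simp [ContactIsotopy.precomp]

end ContactGeom

end

theorem mainTheorem2 {n : ℕ} {M : Type*} [TopologicalSpace M]
    [ChartedSpace (ContactGeom.Model n) M] [IsManifold (𝓡 (2 * n + 1)) ∞ M]
    [T2Space M] [CompactSpace M]
    (C : ContactGeom.CoorientedContactStructure n M)
    (α : ContactGeom.ContactForm n M) (hα : α.Defines C) :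
    (∀ U : Set (ContactGeom.Cont₀ C),
      IsOpen[ContactGeom.intervalTopology C] U → IsOpen[ContactGeom.hoferTopology C α] U) ∧
    ∀ φ : ContactGeom.Cont₀ C,
      IsOpen[ContactGeom.hoferTopology C α] (ContactGeom.chronFuture φ) ∧
      IsOpen[ContactGeom.hoferTopology C α] (ContactGeom.chronPast φ) := by
  refine ⟨fun U hU => ?_, fun φ =>
    ⟨ContactGeom.isOpen_chronFuture hα φ, ContactGeom.isOpen_chronPast hα φ⟩⟩
  -- In the order on topologies, the smaller one is the finer one; it suffices to test the
  -- generators.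
  have hle : ContactGeom.hoferTopology C α ≤ ContactGeom.intervalTopology C := by
    refine le_generateFrom ?_
    rintro _ ⟨φ, ψ, rfl⟩
    exact (ContactGeom.hoferTopology C α).isOpen_inter _ _
      (ContactGeom.isOpen_chronFuture hα φ) (ContactGeom.isOpen_chronPast hα ψ)
  exact hle U hU
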